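/- Let $\Omega\subset\mathbb R^d$ be a bounded open set (for instance a bounded Lipschitz domain), let $1\le s\le 2$ (for instance $s=d/(d-1)$ with $d\ge 2$, or $s=2$), let $T:L^{s}(\Omega)\to L^2(\Omega)$ be bounded and linear, with adjoint $T^*:L^2(\Omega)\to L^s(\Omega)^*$, and let $B:=T^*T$ and $f\in L^2(\Omega)$. Let $\alpha_0,\alpha_1\in C(\overline\Omega)$ with $\alpha_0,\alpha_1>\underline\alpha$ on $\Omega$ for some constant $\underline\alpha>0$, and let $\mu,\alpha,\gamma_0,\gamma_1>0$ be constants. Let $\mathcal S^{d\times d}$ denote the symmetric $d\times d$ matrices, $|\cdot|$ the Euclidean norm on $\mathbb R^d$ and the Frobenius norm on $\mathbb R^{d\times d}$, and $Ew=\frac12(\nabla w+(\nabla w)^\top)$. For $\gamma>0$ let $\varphi_\gamma$ be the Huber function, $\varphi_\gamma(v)=|v|-\frac{\gamma}{2}$ if $|v|\ge\gamma$ and $\varphi_\gamma(v)=\frac1{2\gamma}|v|^2$ if $|v|<\gamma$. Put $\hat X=H^1(\Omega,\mathbb R^d)\times H^1(\Omega)$, $\hat Y=L^2(\Omega,\mathcal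 S^{d\times d})\times L^2(\Omega,\mathbb R^d)$, $R:\hat X\to\hat Y$, $R(w,u)=(Ew,\nabla u-w)$, and $$Q_1(w,u)=\tfrac12\|Tu-f\|_{L^2(\Omega)}^2+\tfrac{\mu}{2}\|\nabla u\|_{L^2(\Omega)}^2+\tfrac{\alpha}{2}\|w\|_{H^1(\Omega,\mathbb R^d)}^2,\qquad Q_2(\psi,\phi)=\int_\Omega\alpha_1\varphi_{\gamma_1}(\phi)\,dx+\int_\Omega\alpha_0\varphi_{\gamma_0}(\psi)\,dx .$$ The regularized primal problem $(P_\gamma)$ is to minimize $$Q_1(w,u)+Q_2(R(w,u))=\tfrac12\|Tu-f\|_{L^2}^2+\int_\Omega\alpha_1\varphi_{\gamma_1}(\nabla u-w)\,dx+\int_\Omega\alpha_0\varphi_{\gamma_0}(Ew)\,dx+\tfrac\mu2\|\nabla u\|_{L^2}^2+\tfrac\alpha2\|w\|_{H^1}^2$$ over $(w,u)\in\hat X$. Its predual problem is to minimize $Q_1^*(-R^*(p,q))+Q_2^*(p,q)$ over $(p,q)\in\hat Y$, where $F^*(\xi)=\sup_x\,(\langle\xi,x\rangle-F(x))\in(-\infty,+\infty]$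 is the Fenchel conjugate, $\hat Y$ is identified with its dual through the $L^2$ inner product, and $R^*:\hat Y\to\hat X^*$ is the adjoint of $R$. Let $(w,u)\in H^1(\Omega,\mathbb R^d)\times H^1(\Omega)$ and $(p,q)\in L^2(\Omega,\mathbb R^{d\times d})\times L^2(\Omega,\mathbb R^d)$. Then $(w,u)$ is a solution of $(P_\gamma)$ and $(p,q)$ is a solution of its predual problem (in particular $p$ is symmetric a.e.) if and only if $$\begin{aligned} &Bu-\mu\Delta u+\nabla^*q-T^*f=0 &&\text{in } H^1(\Omega)^*, &&(Opt_1)\\ &\alpha w-\alpha\Delta w-q+E^*p=0 &&\text{in } H^1(\Omega,\mathbb R^d)^*, &&(Opt_2)\\ &\max(|\nabla u-w|,\gamma_1)\,q-\alpha_1(\nabla u-w)=0 &&\text{a.e. in }\Omega, &&(Opt_3)\\ &\max(|Ew|,\gamma_0)\,p-\alpha_0Ew=0 &&\text{a.e. in }\Omega. &&(Opt_4) \end{aligned}$$ Here $\Delta$, $\nabla^*$, $E^*$ are meant weakly with natural boundary conditions: $\langle-\Delta u,v\rangle=\int_\Omega\nabla u\cdot\nabla v$, $\langle-\Delta w,\omega\rangle=\int_\Omega\nabla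 w:\nabla\omega$, $\langle\nabla^*q,v\rangle=\int_\Omega q\cdot\nabla v$, $\langle E^*p,\omega\rangle=\int_\Omega p:E\omega$, while $\langle Bu,v\rangle=\int_\Omega Tu\,Tv$, $\langle T^*f,v\rangle=\int_\Omega f\,Tv$, and $w,q$ act on $\omega\in H^1(\Omega,\mathbb R^d)$ through the $L^2$ inner product. -/

import Mathlib

open MeasureTheory
open scoped ENNReal ContDiff

namespace TGV

/-- `ℝ^d` with the Euclidean norm. -/
abbrev Vec (d : ℕ) := EuclideanSpace ℝ (Fin d)

/-- `ℝ^{d×d}` with the Frobenius norm; the entry in row `i` and column `j` of `M` is `M (i, j)`. -/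
abbrev Mat (d : ℕ) := EuclideanSpace ℝ (Fin d × Fin d)

/-- The Hilbert space `L²(Ω, F)`. -/
noncomputable abbrev L2 {d : ℕ} (Ω : Set (Vec d)) (F : Type*) [NormedAddCommGroup F] :=
  Lp F 2 (volume.restrict Ω)

section WeakDerivatives

variable {d : ℕ}

/-- `g` is the weak partial derivative `∂_j f` in `Ω`: `∫_Ω f ∂_j φ = - ∫_Ω g φ` for every
`φ ∈ C_c^∞(Ω)`. -/
def IsWeakPartial (Ω : Set (Vec d)) (j : Fin d) (f g : Vec d → ℝ) : Prop :=
  ∀ φ : Vec d → ℝ, ContDiff ℝ ∞ φ → HasCompactSupport φ → tsupport φ ⊆ Ω →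
    ∫ x in Ω, f x * fderiv ℝ φ x (EuclideanSpace.single j 1) = - ∫ x in Ω, g x * φ x

theorem IsWeakPartial.congr {Ω : Set (Vec d)} {j : Fin d} {f g f' g' : Vec d → ℝ}
    (h : IsWeakPartial Ω j f g) (hf : f' =ᵐ[volume.restrict Ω] f)
    (hg : g' =ᵐ[volume.restrict Ω] g) : IsWeakPartial Ω j f' g' := by
  intro φ h1 h2 h3
  have e1 : ∫ x in Ω, f' x * fderiv ℝ φ x (EuclideanSpace.single j 1)
      = ∫ x in Ω, f x * fderiv ℝ φ x (EuclideanSpace.single j 1) := by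
    apply integral_congr_ae
    filter_upwards [hf] with x hx
    rw [hx]
  have e2 : ∫ x in Ω, g' x * φ x = ∫ x in Ω, g x * φ x := by
    apply integral_congr_ae
    filter_upwards [hg] with x hx
    rw [hx]
  rw [e1, e2, h φ h1 h2 h3]

theorem IsWeakPartial.zero (Ω : Set (Vec d)) (j : Fin d) :
    IsWeakPartial Ω j (fun _ => 0) (fun _ => 0) := by
  intro φ _ _ _
  simp

theorem IsWeakPartial.const_mul {Ω : Set (Vec d)} {j : Fin d} {f g : Vec d → ℝ}
    (h : IsWeakPartial Ω j f g) (c : ℝ) :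
    IsWeakPartial Ω j (fun x => c * f x) (fun x => c * g x) := by
  intro φ h1 h2 h3
  simp only [mul_assoc, integral_const_mul]
  rw [h φ h1 h2 h3]
  ring

theorem integrable_mul_of_hasCompactSupport {Ω : Set (Vec d)} {f ψ : Vec d → ℝ}
    (hf : MemLp f 2 (volume.restrict Ω)) (hψ : Continuous ψ) (hc : HasCompactSupport ψ) :
    Integrable (fun x => f x * ψ x) (volume.restrict Ω) :=
  MemLp.integrable_mul (p := 2) (q := 2) hf
    ((hψ.memLp_of_hasCompactSupport (μ := volume) (p := 2) hc).restrict Ω)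

theorem IsWeakPartial.add {Ω : Set (Vec d)} {j : Fin d} {f g f' g' : Vec d → ℝ}
    (h : IsWeakPartial Ω j f g) (h' : IsWeakPartial Ω j f' g')
    (hf : MemLp f 2 (volume.restrict Ω)) (hg : MemLp g 2 (volume.restrict Ω))
    (hf' : MemLp f' 2 (volume.restrict Ω)) (hg' : MemLp g' 2 (volume.restrict Ω)) :
    IsWeakPartial Ω j (fun x => f x + f' x) (fun x => g x + g' x) := by
  intro φ h1 h2 h3
  have c1 : Continuous (fun x => fderiv ℝ φ x (EuclideanSpace.single j 1)) :=
    (h1.continuous_fderiv (by simp)).clm_apply continuous_const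
  have c2 : HasCompactSupport (fun x => fderiv ℝ φ x (EuclideanSpace.single j 1)) :=
    h2.fderiv_apply ℝ (EuclideanSpace.single j 1)
  simp only [add_mul]
  rw [integral_add (integrable_mul_of_hasCompactSupport hf c1 c2)
      (integrable_mul_of_hasCompactSupport hf' c1 c2),
    integral_add (integrable_mul_of_hasCompactSupport hg h1.continuous h2)
      (integrable_mul_of_hasCompactSupport hg' h1.continuous h2),
    h φ h1 h2 h3, h' φ h1 h2 h3]
  ring

theorem memLp_coord {Ω : Set (Vec d)} {ι : Type*} [Fintype ι]
    (g : L2 Ω (EuclideanSpace ℝ ι)) (k : ι) :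
    MemLp (fun x => g x k) 2 (volume.restrict Ω) :=
  (EuclideanSpace.proj k : EuclideanSpace ℝ ι →L[ℝ] ℝ).comp_memLp' (Lp.memLp g)

end WeakDerivatives

noncomputable section

section SobolevSpaces

variable {d : ℕ}

/-- The Sobolev space `H¹(Ω)`, as the graph `{(u, ∇u)} ⊆ L²(Ω) × L²(Ω, ℝ^d)` of the weak gradient,
with the Hilbert norm `‖u‖² + ‖∇u‖²`. -/
def H1 (Ω : Set (Vec d)) : Submodule ℝ (WithLp 2 (L2 Ω ℝ × L2 Ω (Vec d))) where
  carrier := {z | ∀ j, IsWeakPartial Ω j (fun x => z.fst x) (fun x => z.snd x j)}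
  zero_mem' := by
    intro j
    refine (IsWeakPartial.zero Ω j).congr ?_ ?_
    · filter_upwards [Lp.coeFn_zero ℝ 2 (volume.restrict Ω)] with x hx
      exact hx
    · filter_upwards [Lp.coeFn_zero (Vec d) 2 (volume.restrict Ω)] with x hx
      exact congrArg (fun v : Vec d => v j) hx
  add_mem' := by
    intro y z hy hz j
    refine ((hy j).add (hz j) (Lp.memLp y.fst) (memLp_coord y.snd j) (Lp.memLp z.fst)
      (memLp_coord z.snd j)).congr ?_ ?_
    · filter_upwards [Lp.coeFn_add y.fst z.fst] with x hx
      exact hx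
    · filter_upwards [Lp.coeFn_add y.snd z.snd] with x hx
      exact congrArg (fun v : Vec d => v j) hx
  smul_mem' := by
    intro c z hz j
    refine ((hz j).const_mul c).congr ?_ ?_
    · filter_upwards [Lp.coeFn_smul c z.fst] with x hx
      exact hx
    · filter_upwards [Lp.coeFn_smul c z.snd] with x hx
      exact congrArg (fun v : Vec d => v j) hx

/-- The Sobolev space `H¹(Ω, ℝ^d)`, as the graph `{(w, ∇w)} ⊆ L²(Ω, ℝ^d) × L²(Ω, ℝ^{d×d})` of the
weak Jacobian `(∇w)_{ij} = ∂_j w_i`, with the Hilbert norm `‖w‖² + ‖∇w‖²`. -/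
def H1Vec (Ω : Set (Vec d)) : Submodule ℝ (WithLp 2 (L2 Ω (Vec d) × L2 Ω (Mat d))) where
  carrier := {z | ∀ i j, IsWeakPartial Ω j (fun x => z.fst x i) (fun x => z.snd x (i, j))}
  zero_mem' := by
    intro i j
    refine (IsWeakPartial.zero Ω j).congr ?_ ?_
    · filter_upwards [Lp.coeFn_zero (Vec d) 2 (volume.restrict Ω)] with x hx
      exact congrArg (fun v : Vec d => v i) hx
    · filter_upwards [Lp.coeFn_zero (Mat d) 2 (volume.restrict Ω)] with x hx
      exact congrArg (fun v : Mat d => v (i, j)) hx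
  add_mem' := by
    intro y z hy hz i j
    refine ((hy i j).add (hz i j) (memLp_coord y.fst i) (memLp_coord y.snd (i, j))
      (memLp_coord z.fst i) (memLp_coord z.snd (i, j))).congr ?_ ?_
    · filter_upwards [Lp.coeFn_add y.fst z.fst] with x hx
      exact congrArg (fun v : Vec d => v i) hx
    · filter_upwards [Lp.coeFn_add y.snd z.snd] with x hx
      exact congrArg (fun v : Mat d => v (i, j)) hx
  smul_mem' := by
    intro c z hz i j
    refine ((hz i j).const_mul c).congr ?_ ?_
    · filter_upwards [Lp.coeFn_smul c z.fst] with x hx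
      exact congrArg (fun v : Vec d => v i) hx
    · filter_upwards [Lp.coeFn_smul c z.snd] with x hx
      exact congrArg (fun v : Mat d => v (i, j)) hx

/-- The inclusion `H¹(Ω) → L²(Ω)`. -/
def toL2 (Ω : Set (Vec d)) : H1 Ω →L[ℝ] L2 Ω ℝ :=
  (WithLp.fstL 2 ℝ (L2 Ω ℝ) (L2 Ω (Vec d))).comp (H1 Ω).subtypeL

/-- The weak gradient `∇ : H¹(Ω) → L²(Ω, ℝ^d)`. -/
def grad (Ω : Set (Vec d)) : H1 Ω →L[ℝ] L2 Ω (Vec d) :=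
  (WithLp.sndL 2 ℝ (L2 Ω ℝ) (L2 Ω (Vec d))).comp (H1 Ω).subtypeL

/-- The inclusion `H¹(Ω, ℝ^d) → L²(Ω, ℝ^d)`. -/
def toL2Vec (Ω : Set (Vec d)) : H1Vec Ω →L[ℝ] L2 Ω (Vec d) :=
  (WithLp.fstL 2 ℝ (L2 Ω (Vec d)) (L2 Ω (Mat d))).comp (H1Vec Ω).subtypeL

/-- The weak Jacobian `∇ : H¹(Ω, ℝ^d) → L²(Ω, ℝ^{d×d})`. -/
def jac (Ω : Set (Vec d)) : H1Vec Ω →L[ℝ] L2 Ω (Mat d) :=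
  (WithLp.sndL 2 ℝ (L2 Ω (Vec d)) (L2 Ω (Mat d))).comp (H1Vec Ω).subtypeL

/-- The symmetric part `(M + Mᵀ) / 2` of a matrix. -/
def symPart (d : ℕ) : Mat d →L[ℝ] Mat d :=
  LinearMap.toContinuousLinearMap
    { toFun := fun M => WithLp.toLp 2 (fun k => (M k + M k.swap) / 2)
      map_add' := by
        intro M N
        ext k
        simp only [PiLp.add_apply]
        ring
      map_smul' := by
        intro c M
        ext k
        simp only [PiLp.smul_apply, smul_eq_mul, RingHom.id_apply]
        ring }

/-- `L²(Ω, S^{d×d})`, the subspace of `L²(Ω, ℝ^{d×d})` of the functions whose values are symmetric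
matrices almost everywhere. -/
def L2Sym (Ω : Set (Vec d)) : Submodule ℝ (L2 Ω (Mat d)) where
  carrier := {p | ∀ᵐ x ∂(volume.restrict Ω), ∀ i j, p x (i, j) = p x (j, i)}
  zero_mem' := by
    filter_upwards [Lp.coeFn_zero (Mat d) 2 (volume.restrict Ω)] with x hx i j
    rw [hx]
    rfl
  add_mem' := by
    intro p p' h h'
    filter_upwards [h, h', Lp.coeFn_add p p'] with x hx hx' e i j
    rw [e]
    simp [hx i j, hx' i j]
  smul_mem' := by
    intro c p h
    filter_upwards [h, Lp.coeFn_smul c p] with x hx e i j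
    rw [e]
    simp [hx i j]

/-- The symmetrized gradient `E w = (∇w + (∇w)ᵀ) / 2`, as a map
`E : H¹(Ω, ℝ^d) → L²(Ω, S^{d×d})`. -/
def symGrad (Ω : Set (Vec d)) : H1Vec Ω →L[ℝ] L2Sym Ω :=
  (((symPart d).compLpL 2 (volume.restrict Ω)).comp (jac Ω)).codRestrict (L2Sym Ω) (by
    intro w
    change ∀ᵐ x ∂(volume.restrict Ω), ∀ i j, _ = _
    filter_upwards [(symPart d).coeFn_compLpL (p := 2) (μ := volume.restrict Ω) (jac Ω w)]
      with x hx i j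
    rw [ContinuousLinearMap.comp_apply, hx]
    simp [symPart, add_comm])

/-- The inclusion `L²(Ω) → L^s(Ω)` for bounded `Ω` and `s ≤ 2`. -/
def toLs {Ω : Set (Vec d)} (hb : Bornology.IsBounded Ω) {s : ℝ≥0∞} [Fact (1 ≤ s)] (hs : s ≤ 2) :
    L2 Ω ℝ →L[ℝ] Lp ℝ s (volume.restrict Ω) :=
  haveI : IsFiniteMeasure (volume.restrict Ω) := ⟨by simpa using hb.measure_lt_top⟩
  LinearMap.mkContinuous
    { toFun := fun v => ((Lp.memLp v).mono_exponent hs).toLp v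
      map_add' := by
        intro v v'
        rw [← MemLp.toLp_add]
        exact MemLp.toLp_congr _ _ (Lp.coeFn_add v v')
      map_smul' := by
        intro c v
        rw [RingHom.id_apply, ← MemLp.toLp_const_smul]
        exact MemLp.toLp_congr _ _ (Lp.coeFn_smul c v) }
    (((volume.restrict Ω) Set.univ ^ (1 / s.toReal - 1 / (2 : ℝ≥0∞).toReal)).toReal) (by
      intro v
      have hs0 : 0 < s := lt_of_lt_of_le one_pos Fact.out
      have hexp : 0 ≤ 1 / s.toReal - 1 / (2 : ℝ≥0∞).toReal := by
        have h2 : s.toReal ≤ (2 : ℝ≥0∞).toReal := ENNReal.toReal_mono (by simp) hs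
        have h1 : 0 < s.toReal := ENNReal.toReal_pos hs0.ne' (ne_top_of_le_ne_top (by simp) hs)
        exact sub_nonneg.2 (one_div_le_one_div_of_le h1 h2)
      have hfin : (volume.restrict Ω) Set.univ ^ (1 / s.toReal - 1 / (2 : ℝ≥0∞).toReal) ≠ ⊤ :=
        ENNReal.rpow_ne_top_of_nonneg hexp (measure_ne_top _ _)
      simp only [LinearMap.coe_mk, AddHom.coe_mk, Lp.norm_def]
      rw [eLpNorm_congr_ae (MemLp.coeFn_toLp _), mul_comm, ← ENNReal.toReal_mul]
      exact ENNReal.toReal_mono (ENNReal.mul_ne_top (Lp.eLpNorm_ne_top v) hfin)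
        (eLpNorm_le_eLpNorm_mul_rpow_measure_univ hs (Lp.aestronglyMeasurable v)))

/-- The inclusion `H¹(Ω) → L^s(Ω)` for bounded `Ω` and `s ≤ 2`. -/
def H1toLs {Ω : Set (Vec d)} (hb : Bornology.IsBounded Ω) {s : ℝ≥0∞} [Fact (1 ≤ s)]
    (hs : s ≤ 2) : H1 Ω →L[ℝ] Lp ℝ s (volume.restrict Ω) :=
  (toLs hb hs).comp (toL2 Ω)

end SobolevSpaces

section DualOperators

variable {d : ℕ}

/-- The adjoint `T* : L²(Ω) → L^s(Ω)*` of `T : L^s(Ω) → L²(Ω)`, `⟨T* g, v⟩ = ∫_Ω g T v`. -/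
def adjT {Ω : Set (Vec d)} {s : ℝ≥0∞} [Fact (1 ≤ s)]
    (T : Lp ℝ s (volume.restrict Ω) →L[ℝ] L2 Ω ℝ) (g : L2 Ω ℝ) :
    StrongDual ℝ (Lp ℝ s (volume.restrict Ω)) :=
  (innerSL ℝ g).comp T

/-- `B = T* T : L^s(Ω) → L^s(Ω)*`. -/
def opB {Ω : Set (Vec d)} {s : ℝ≥0∞} [Fact (1 ≤ s)]
    (T : Lp ℝ s (volume.restrict Ω) →L[ℝ] L2 Ω ℝ) (v : Lp ℝ s (volume.restrict Ω)) :
    StrongDual ℝ (Lp ℝ s (volume.restrict Ω)) :=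
  adjT T (T v)

/-- The weak Laplacian `Δ : H¹(Ω) → H¹(Ω)*`, `⟨Δu, v⟩ = - ∫_Ω ∇u · ∇v`. -/
def lap {Ω : Set (Vec d)} (u : H1 Ω) : StrongDual ℝ (H1 Ω) :=
  -((innerSL ℝ (grad Ω u)).comp (grad Ω))

/-- The weak Laplacian `Δ : H¹(Ω, ℝ^d) → H¹(Ω, ℝ^d)*`, `⟨Δw, ω⟩ = - ∫_Ω ∇w : ∇ω`. -/
def lapVec {Ω : Set (Vec d)} (w : H1Vec Ω) : StrongDual ℝ (H1Vec Ω) :=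
  -((innerSL ℝ (jac Ω w)).comp (jac Ω))

/-- `∇* : L²(Ω, ℝ^d) → H¹(Ω)*`, `⟨∇* q, v⟩ = ∫_Ω q · ∇v`. -/
def gradAdj {Ω : Set (Vec d)} (q : L2 Ω (Vec d)) : StrongDual ℝ (H1 Ω) :=
  (innerSL ℝ q).comp (grad Ω)

/-- `E* : L²(Ω, ℝ^{d×d}) → H¹(Ω, ℝ^d)*`, `⟨E* p, ω⟩ = ∫_Ω p : E ω`. -/
def symGradAdj {Ω : Set (Vec d)} (p : L2 Ω (Mat d)) : StrongDual ℝ (H1Vec Ω) :=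
  (innerSL ℝ p).comp ((L2Sym Ω).subtypeL.comp (symGrad Ω))

/-- `L²(Ω, ℝ^d) ⊆ H¹(Ω, ℝ^d)*`, `⟨g, ω⟩ = ∫_Ω g · ω`. -/
def l2Dual {Ω : Set (Vec d)} (g : L2 Ω (Vec d)) : StrongDual ℝ (H1Vec Ω) :=
  (innerSL ℝ g).comp (toL2Vec Ω)

end DualOperators

section Problems

variable {d : ℕ}

/-- The Huber function with parameter `γ > 0`. -/
def huber {F : Type*} [NormedAddCommGroup F] (γ : ℝ) (v : F) : ℝ :=
  if γ ≤ ‖v‖ then ‖v‖ - γ / 2 else ‖v‖ ^ 2 / (2 * γ)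

/-- The Fenchel conjugate `F*(ξ) = sup_x ⟨ξ, x⟩ - F(x)` of a real-valued function `F`. -/
def fenchelConj {X : Type*} [NormedAddCommGroup X] [NormedSpace ℝ X] (F : X → ℝ)
    (ξ : StrongDual ℝ X) : EReal :=
  ⨆ x : X, ((ξ x - F x : ℝ) : EReal)

/-- `Q₁(w, u) = ½‖T u - f‖² + (μ/2)‖∇u‖² + (α/2)‖w‖²_{H¹}`. -/
def Q₁ {Ω : Set (Vec d)} (hb : Bornology.IsBounded Ω) {s : ℝ≥0∞} [Fact (1 ≤ s)] (hs : s ≤ 2)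
    (T : Lp ℝ s (volume.restrict Ω) →L[ℝ] L2 Ω ℝ) (f : L2 Ω ℝ) (μ α : ℝ)
    (z : H1Vec Ω × H1 Ω) : ℝ :=
  1 / 2 * ‖T (H1toLs hb hs z.2) - f‖ ^ 2 + μ / 2 * ‖grad Ω z.2‖ ^ 2 + α / 2 * ‖z.1‖ ^ 2

/-- `Q₂(ψ, φ) = ∫_Ω α₁ φ_{γ₁}(φ) + ∫_Ω α₀ φ_{γ₀}(ψ)`, where `φ_γ` is the Huber function. -/
def Q₂ (Ω : Set (Vec d)) (α₀ α₁ : Vec d → ℝ) (γ₀ γ₁ : ℝ) (y : L2Sym Ω × L2 Ω (Vec d)) : ℝ :=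
  (∫ x in Ω, α₁ x * huber γ₁ (y.2 x)) + ∫ x in Ω, α₀ x * huber γ₀ ((y.1 : L2 Ω (Mat d)) x)

/-- `R(w, u) = (E w, ∇u - w)`. -/
def opR (Ω : Set (Vec d)) : (H1Vec Ω × H1 Ω) →L[ℝ] (L2Sym Ω × L2 Ω (Vec d)) :=
  ((symGrad Ω).comp (ContinuousLinearMap.fst ℝ (H1Vec Ω) (H1 Ω))).prod
    ((grad Ω).comp (ContinuousLinearMap.snd ℝ (H1Vec Ω) (H1 Ω)) -
      (toL2Vec Ω).comp (ContinuousLinearMap.fst ℝ (H1Vec Ω) (H1 Ω)))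

/-- The identification of `L²(Ω, S^{d×d}) × L²(Ω, ℝ^d)` with its dual space:
`⟨(p, q), (ψ, φ)⟩ = ∫_Ω p : ψ + ∫_Ω q · φ`. -/
def pairing {Ω : Set (Vec d)} (y : L2Sym Ω × L2 Ω (Vec d)) :
    StrongDual ℝ (L2Sym Ω × L2 Ω (Vec d)) :=
  (innerSL ℝ y.1).comp (ContinuousLinearMap.fst ℝ (L2Sym Ω) (L2 Ω (Vec d))) +
    (innerSL ℝ y.2).comp (ContinuousLinearMap.snd ℝ (L2Sym Ω) (L2 Ω (Vec d)))

/-- The objective `Q₁(w, u) + Q₂(R(w, u))` of the regularized primal problem. -/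
def primalObj {Ω : Set (Vec d)} (hb : Bornology.IsBounded Ω) {s : ℝ≥0∞} [Fact (1 ≤ s)]
    (hs : s ≤ 2) (T : Lp ℝ s (volume.restrict Ω) →L[ℝ] L2 Ω ℝ) (f : L2 Ω ℝ)
    (α₀ α₁ : Vec d → ℝ) (μ α γ₀ γ₁ : ℝ) (z : H1Vec Ω × H1 Ω) : ℝ :=
  Q₁ hb hs T f μ α z + Q₂ Ω α₀ α₁ γ₀ γ₁ (opR Ω z)

/-- The objective `Q₁*(-R*(p, q)) + Q₂*(p, q)` of the predual problem, which is to be minimized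
over `L²(Ω, S^{d×d}) × L²(Ω, ℝ^d)`. The value is never `⊥`, since `Q₁` and `Q₂` are finite. -/
def predualObj {Ω : Set (Vec d)} (hb : Bornology.IsBounded Ω) {s : ℝ≥0∞} [Fact (1 ≤ s)]
    (hs : s ≤ 2) (T : Lp ℝ s (volume.restrict Ω) →L[ℝ] L2 Ω ℝ) (f : L2 Ω ℝ)
    (α₀ α₁ : Vec d → ℝ) (μ α γ₀ γ₁ : ℝ) (y : L2Sym Ω × L2 Ω (Vec d)) : EReal :=
  fenchelConj (Q₁ hb hs T f μ α) (-((pairing y).comp (opR Ω))) +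
    fenchelConj (Q₂ Ω α₀ α₁ γ₀ γ₁) (pairing y)

/-- `(w, u)` solves the regularized primal problem. -/
def IsPrimalSolution {Ω : Set (Vec d)} (hb : Bornology.IsBounded Ω) {s : ℝ≥0∞} [Fact (1 ≤ s)]
    (hs : s ≤ 2) (T : Lp ℝ s (volume.restrict Ω) →L[ℝ] L2 Ω ℝ) (f : L2 Ω ℝ)
    (α₀ α₁ : Vec d → ℝ) (μ α γ₀ γ₁ : ℝ) (w : H1Vec Ω) (u : H1 Ω) : Prop :=
  ∀ z : H1Vec Ω × H1 Ω, primalObj hb hs T f α₀ α₁ μ α γ₀ γ₁ (w, u) ≤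
    primalObj hb hs T f α₀ α₁ μ α γ₀ γ₁ z

/-- `(p, q)` solves the predual problem; in particular `p` takes symmetric values. -/
def IsPredualSolution {Ω : Set (Vec d)} (hb : Bornology.IsBounded Ω) {s : ℝ≥0∞} [Fact (1 ≤ s)]
    (hs : s ≤ 2) (T : Lp ℝ s (volume.restrict Ω) →L[ℝ] L2 Ω ℝ) (f : L2 Ω ℝ)
    (α₀ α₁ : Vec d → ℝ) (μ α γ₀ γ₁ : ℝ) (p : L2 Ω (Mat d)) (q : L2 Ω (Vec d)) : Prop :=
  ∃ hp : p ∈ L2Sym Ω, ∀ y : L2Sym Ω × L2 Ω (Vec d),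
    predualObj hb hs T f α₀ α₁ μ α γ₀ γ₁ (⟨p, hp⟩, q) ≤
      predualObj hb hs T f α₀ α₁ μ α γ₀ γ₁ y

end Problems

end

end TGV

/-! The theorem is Fenchel duality for a pair of convex functions that are smooth enough to have a
single subgradient at the points involved. `HasQuadExpansion` records this: `D` supports `F` at `x`,
while along each line through `x` the excess over the tangent is at most quadratic. This forces
every subgradient at `x` to equal `D`, passes to sums and to compositions with linear maps, and
turns minimality into `D = 0`.

Let `D` be the gradient of Q₁ at (w, u), and let g be the L² representative of the gradient of Q₂ at
R(w, u). Primal optimality reads D + R*g = 0. Then g itself is a predual point whose value is minus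
the primal value, which is a lower bound for the predual by Fenchel–Young. There is thus no duality
gap, and no constraint qualification is needed. A predual solution (p, q) has the same value, so
equality in Fenchel–Young makes it a subgradient of Q₂ at R(w, u), that is, (p, q) = g. Conversely,
D + R*(p, q) = 0 with (p, q) = g gives both optimalities.

The two components of D + R*(p, q) = 0 are (Opt_1) and (Opt_2). The gradient of the Huber function
is v / max(|v|, γ), so (p, q) = g is (Opt_3) and (Opt_4) after clearing the denominator, which is at
least γ > 0. -/

open Filter
open scoped InnerProductSpace

namespace TGV

/-! ### Fenchel duality for functions with a unique subgradient. -/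

section Duality

variable {X Y ι : Type*} [NormedAddCommGroup X] [NormedSpace ℝ X] [NormedAddCommGroup Y]
  [NormedSpace ℝ Y]

/-- `D` is a subgradient of `F` at `x`, and `F` lies below a parabola with slope `D` along every
line through `x`. -/
structure HasQuadExpansion (F : X → ℝ) (x : X) (D : StrongDual ℝ X) : Prop where
  lower : ∀ h, F x + D h ≤ F (x + h)
  upper : ∀ h, ∃ c : ℝ, ∀ t : ℝ, F (x + t • h) ≤ F x + t * D h + t ^ 2 * c

theorem eq_zero_of_forall_mul_le_sq {a c : ℝ} (h : ∀ t : ℝ, t * a ≤ t ^ 2 * c) : a = 0 := by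
  by_contra ha
  have hc : 0 < |c| + 1 := by positivity
  -- For this `t` the hypothesis reduces to `|c| + 1 ≤ c`, which is absurd.
  have h1 := h (a / (|c| + 1))
  have h2 : 0 < a ^ 2 := by positivity
  have h3 : a / (|c| + 1) * a = a ^ 2 / (|c| + 1) ^ 2 * (|c| + 1) := by field_simp
  rw [h3, div_pow] at h1
  have h4 : 0 < a ^ 2 / (|c| + 1) ^ 2 := by positivity
  nlinarith [le_abs_self c, le_of_mul_le_mul_left h1 h4]

/-- Along `t • h` the two bounds give `t * (ξ h - D h) ≤ t ^ 2 * c` for `t` of both signs, so the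
linear term vanishes. -/
theorem HasQuadExpansion.eq_of_subgradient {F : X → ℝ} {x : X} {D ξ : StrongDual ℝ X}
    (hD : HasQuadExpansion F x D) (hξ : ∀ h, F x + ξ h ≤ F (x + h)) : ξ = D := by
  ext h
  obtain ⟨c, hc⟩ := hD.upper h
  refine sub_eq_zero.1 (eq_zero_of_forall_mul_le_sq (c := c) fun t => ?_)
  have h1 := hξ (t • h)
  rw [map_smul, smul_eq_mul] at h1
  linarith [hc t]

theorem HasQuadExpansion.add_comp {F : X → ℝ} {G : Y → ℝ} {R : X →L[ℝ] Y} {x : X}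
    {D : StrongDual ℝ X} {D' : StrongDual ℝ Y} (hF : HasQuadExpansion F x D)
    (hG : HasQuadExpansion G (R x) D') :
    HasQuadExpansion (fun z => F z + G (R z)) x (D + D'.comp R) where
  lower h := by
    have h2 := hG.lower (R h)
    rw [← map_add] at h2
    simp only [add_apply, ContinuousLinearMap.comp_apply]
    linarith [hF.lower h]
  upper h := by
    obtain ⟨c, hc⟩ := hF.upper h
    obtain ⟨c', hc'⟩ := hG.upper (R h)
    refine ⟨c + c', fun t => ?_⟩
    have h2 := hc' t
    rw [← map_smul, ← map_add] at h2
    simp only [add_apply, ContinuousLinearMap.comp_apply]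
    linarith [hc t]

theorem HasQuadExpansion.isMin_iff {F : X → ℝ} {x : X} {D : StrongDual ℝ X}
    (hF : HasQuadExpansion F x D) : (∀ z, F x ≤ F z) ↔ D = 0 := by
  constructor
  · intro h
    exact (hF.eq_of_subgradient (ξ := 0) fun k => by simpa using h (x + k)).symm
  · rintro rfl z
    simpa using hF.lower (z - x)

theorem le_fenchelConj (F : X → ℝ) (ξ : StrongDual ℝ X) (x : X) :
    ((ξ x - F x : ℝ) : EReal) ≤ fenchelConj F ξ :=
  le_iSup (fun x : X => ((ξ x - F x : ℝ) : EReal)) x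

theorem HasQuadExpansion.fenchelConj_eq {F : X → ℝ} {x : X} {D : StrongDual ℝ X}
    (hF : HasQuadExpansion F x D) : fenchelConj F D = ((D x - F x : ℝ) : EReal) := by
  refine le_antisymm (iSup_le fun z => EReal.coe_le_coe_iff.2 ?_) (le_fenchelConj F D x)
  have h := hF.lower (z - x)
  rw [map_sub, add_sub_cancel] at h
  linarith

/-- Weak duality with `v` kept independent of `R x`: `v = R x` bounds the dual from below, and
varying `v` detects subgradients of `G`. -/
theorem fenchel_young_add (F : X → ℝ) (G : Y → ℝ) (R : X →L[ℝ] Y) (η : StrongDual ℝ Y) (x : X)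
    (v : Y) : ((η v - η (R x) - F x - G v : ℝ) : EReal) ≤
      fenchelConj F (-(η.comp R)) + fenchelConj G η := by
  have h := add_le_add (le_fenchelConj F (-(η.comp R)) x) (le_fenchelConj G η v)
  rw [← EReal.coe_add] at h
  refine le_trans (EReal.coe_le_coe_iff.2 (le_of_eq ?_)) h
  simp only [neg_apply, ContinuousLinearMap.comp_apply]
  ring

/-- Fenchel duality: the primal-dual solution pairs are characterized by the extremality
relations. -/
theorem isMin_and_isMin_fenchelConj_iff {F : X → ℝ} {G : Y → ℝ} {R : X →L[ℝ] Y} {x : X}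
    {D : StrongDual ℝ X} {P : ι → StrongDual ℝ Y} {y₀ : ι} (hF : HasQuadExpansion F x D)
    (hG : HasQuadExpansion G (R x) (P y₀)) (y : ι) :
    ((∀ z, F x + G (R x) ≤ F z + G (R z)) ∧
      ∀ y', fenchelConj F (-((P y).comp R)) + fenchelConj G (P y) ≤
        fenchelConj F (-((P y').comp R)) + fenchelConj G (P y')) ↔
    D + (P y).comp R = 0 ∧ P y = P y₀ := by
  have hmin := (hF.add_comp hG).isMin_iff
  have hval : ∀ η : StrongDual ℝ Y, η = P y₀ → D + η.comp R = 0 →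
      fenchelConj F (-(η.comp R)) + fenchelConj G η =
        ((-(F x) - G (R x) : ℝ) : EReal) := by
    rintro η rfl h0
    rw [← eq_neg_of_add_eq_zero_left h0, hF.fenchelConj_eq, hG.fenchelConj_eq, ← EReal.coe_add,
      eq_neg_of_add_eq_zero_left h0]
    simp only [neg_apply, ContinuousLinearMap.comp_apply]
    congr 1
    ring
  constructor
  · rintro ⟨h1, h2⟩
    have h0 := hmin.1 h1
    -- The dual value at `y` is at most `-(F x) - G (R x)`, the value at `y₀`. Fenchel–Young at `v =
    -- R x + k` then leaves exactly the subgradient inequality for `P y`.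
    have hy : P y = P y₀ := hG.eq_of_subgradient fun k => by
      have h3 := (fenchel_young_add F G R (P y) x (R x + k)).trans
        ((h2 y₀).trans (hval _ rfl h0).le)
      rw [EReal.coe_le_coe_iff, map_add] at h3
      linarith
    exact ⟨hy ▸ h0, hy⟩
  · rintro ⟨h1, h2⟩
    refine ⟨hmin.2 (h2 ▸ h1), fun y' => ?_⟩
    rw [hval _ h2 h1]
    refine le_trans (EReal.coe_le_coe_iff.2 (le_of_eq ?_)) (fenchel_young_add F G R (P y') x (R x))
    ring

end Duality

/-! ### Pointwise estimates for the Huber function and its gradient. -/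

section Huber

section Normed

variable {F : Type*} [NormedAddCommGroup F]

/-- The Huber function is the Moreau envelope of the norm, and this is the bound by an arbitrary
competitor `c`. -/
theorem huber_le_norm_add (γ : ℝ) (hγ : 0 < γ) (b c : F) :
    huber γ b ≤ ‖c‖ + ‖b - c‖ ^ 2 / (2 * γ) := by
  have h1 : ‖b‖ ≤ ‖c‖ + ‖b - c‖ := by simpa using norm_add_le c (b - c)
  have h2 := norm_nonneg (b - c)
  have h3 := norm_nonneg c
  have h4 := norm_nonneg b
  have key : huber γ b * (2 * γ) ≤ ‖c‖ * (2 * γ) + ‖b - c‖ ^ 2 := by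
    unfold huber
    split_ifs with h
    · nlinarith [sq_nonneg (‖b - c‖ - γ)]
    · rw [div_mul_cancel₀ _ (by positivity)]
      push Not at h
      rcases le_total ‖b‖ ‖b - c‖ with h5 | h5 <;> nlinarith
  have h5 : ‖c‖ + ‖b - c‖ ^ 2 / (2 * γ) = (‖c‖ * (2 * γ) + ‖b - c‖ ^ 2) / (2 * γ) := by field_simp
  rw [h5, le_div_iff₀ (by positivity)]
  exact key

theorem huber_nonneg {γ : ℝ} (hγ : 0 < γ) (v : F) : 0 ≤ huber γ v := by
  unfold huber
  split_ifs with h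
  · linarith
  · positivity

theorem huber_le_sq {γ : ℝ} (hγ : 0 < γ) (v : F) : huber γ v ≤ ‖v‖ ^ 2 / (2 * γ) := by
  simpa using huber_le_norm_add γ hγ v 0

theorem measurable_huber [MeasurableSpace F] [OpensMeasurableSpace F] (γ : ℝ) :
    Measurable (huber γ : F → ℝ) := by
  unfold huber
  exact Measurable.ite (measurableSet_le measurable_const measurable_norm)
    (measurable_norm.sub_const _) ((measurable_norm.pow_const 2).div_const _)

end Normed

variable {F : Type*} [NormedAddCommGroup F] [InnerProductSpace ℝ F]

/-- The gradient `v / max(|v|, γ)` of the Huber function. -/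
noncomputable def huberGrad (γ : ℝ) (v : F) : F := (max ‖v‖ γ)⁻¹ • v

theorem norm_huberGrad_le_one {γ : ℝ} (hγ : 0 < γ) (v : F) : ‖huberGrad γ v‖ ≤ 1 := by
  have : 0 < max ‖v‖ γ := lt_max_of_lt_right hγ
  rw [huberGrad, norm_smul, norm_inv, Real.norm_of_nonneg this.le, inv_mul_le_one₀ this]
  exact le_max_left _ _

theorem norm_huberGrad_le {γ : ℝ} (hγ : 0 < γ) (v : F) : ‖huberGrad γ v‖ ≤ γ⁻¹ * ‖v‖ := by
  have : 0 < max ‖v‖ γ := lt_max_of_lt_right hγ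
  rw [huberGrad, norm_smul, norm_inv, Real.norm_of_nonneg this.le]
  gcongr
  exact le_max_right _ _

/-- The gradient attains the dual representation of the Huber function, the supremum of `⟪g, v⟫ - γ
/ 2 * ‖g‖ ^ 2` over `‖g‖ ≤ 1`. -/
theorem huber_eq_inner_sub {γ : ℝ} (hγ : 0 < γ) (v : F) :
    huber γ v = ⟪huberGrad γ v, v⟫_ℝ - γ / 2 * ‖huberGrad γ v‖ ^ 2 := by
  have : 0 < max ‖v‖ γ := lt_max_of_lt_right hγ
  rw [huberGrad, real_inner_smul_left, real_inner_self_eq_norm_sq, norm_smul, norm_inv,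
    Real.norm_of_nonneg this.le, huber]
  split_ifs with h
  · rw [max_eq_left h]
    have : 0 < ‖v‖ := hγ.trans_le h
    field_simp
  · rw [max_eq_right (not_le.1 h).le]
    field_simp
    ring

/-- The minimizer in the Moreau envelope is `v - γ • huberGrad γ v`. -/
theorem huber_eq_norm_add {γ : ℝ} (hγ : 0 < γ) (v : F) :
    huber γ v = ‖v - γ • huberGrad γ v‖ + γ / 2 * ‖huberGrad γ v‖ ^ 2 := by
  have hm : 0 < max ‖v‖ γ := lt_max_of_lt_right hγ
  have h1 : v - γ • huberGrad γ v = (1 - γ / max ‖v‖ γ) • v := by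
    rw [huberGrad, sub_smul, one_smul, smul_smul, div_eq_mul_inv]
  have h2 : 0 ≤ 1 - γ / max ‖v‖ γ := by
    rw [sub_nonneg, div_le_one hm]
    exact le_max_right _ _
  rw [h1, huberGrad, norm_smul, norm_smul, norm_inv, Real.norm_of_nonneg hm.le,
    Real.norm_of_nonneg h2, huber]
  split_ifs with h
  · rw [max_eq_left h]
    have : 0 < ‖v‖ := hγ.trans_le h
    field_simp
    ring
  · rw [max_eq_right (not_le.1 h).le]
    field_simp
    ring

theorem huber_lower {γ : ℝ} (hγ : 0 < γ) (a h : F) :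
    huber γ a + ⟪huberGrad γ a, h⟫_ℝ ≤ huber γ (a + h) := by
  set b := a + h with hb
  have hh : h = b - a := by simp [hb]
  rw [hh, inner_sub_right, huber_eq_inner_sub hγ a]
  have h1 : ⟪huberGrad γ a, b⟫_ℝ ≤ ‖huberGrad γ a‖ * ‖b‖ := real_inner_le_norm _ _
  have h2 := norm_huberGrad_le_one hγ a
  have h3 := norm_nonneg (huberGrad γ a)
  have h4 := norm_nonneg b
  -- By Cauchy–Schwarz only the scalar form of the dual representation remains. The gap in it is `(1
  -- - g) * (‖b‖ - γ) + γ / 2 * (1 - g) ^ 2` for large `b`, and `(γ * g - ‖b‖) ^ 2 / (2 * γ)` for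
  -- small `b`.
  suffices ‖huberGrad γ a‖ * ‖b‖ - γ / 2 * ‖huberGrad γ a‖ ^ 2 ≤ huber γ b by linarith
  generalize ‖huberGrad γ a‖ = g at *
  unfold huber
  split_ifs with h
  · have : 0 ≤ (1 - g) * (‖b‖ - γ) := mul_nonneg (by linarith) (by linarith)
    nlinarith [sq_nonneg (1 - g)]
  · rw [le_div_iff₀ (by positivity)]
    nlinarith [sq_nonneg (γ * g - ‖b‖)]

/-- The envelope at `a + h` is tested with the minimizer belonging to `a`. Expanding the square
gives the gradient term and the quadratic remainder. -/
theorem huber_upper {γ : ℝ} (hγ : 0 < γ) (a h : F) :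
    huber γ (a + h) ≤ huber γ a + ⟪huberGrad γ a, h⟫_ℝ + ‖h‖ ^ 2 / (2 * γ) := by
  refine (huber_le_norm_add γ hγ (a + h) (a - γ • huberGrad γ a)).trans (le_of_eq ?_)
  have h1 : a + h - (a - γ • huberGrad γ a) = γ • huberGrad γ a + h := by abel
  rw [h1, huber_eq_norm_add hγ a, norm_add_sq_real, norm_smul, Real.norm_of_nonneg hγ.le,
    real_inner_smul_left]
  field_simp
  ring

theorem continuous_huberGrad {γ : ℝ} (hγ : 0 < γ) : Continuous (huberGrad γ : F → F) :=
  ((continuous_norm.max continuous_const).inv₀ fun _ => (lt_max_of_lt_right hγ).ne').smul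
    continuous_id

theorem max_smul_sub_eq_zero_iff {γ : ℝ} (hγ : 0 < γ) (c : ℝ) (v g : F) :
    max ‖v‖ γ • g - c • v = 0 ↔ g = c • huberGrad γ v := by
  have hm : max ‖v‖ γ ≠ 0 := (lt_max_of_lt_right hγ).ne'
  rw [sub_eq_zero, huberGrad, smul_comm c, eq_inv_smul_iff₀ hm]

end Huber

/-! ### Gradient of the weighted Huber integral on L². -/

section HuberIntegral

theorem integrable_mul_huber {E F : Type*} [MeasurableSpace E] {ν : Measure E}
    [NormedAddCommGroup F] [MeasurableSpace F] [BorelSpace F] {a : E → ℝ} {C γ : ℝ}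
    (ha : AEStronglyMeasurable a ν) (hC : ∀ᵐ x ∂ν, |a x| ≤ C)
    (hγ : 0 < γ) (v : Lp F 2 ν) : Integrable (fun x => a x * huber γ (v x)) ν := by
  have h1 : Integrable (fun x => ‖v x‖ ^ 2) ν := (Lp.memLp v).integrable_norm_pow (by norm_num)
  refine (h1.const_mul (C * (2 * γ)⁻¹)).mono' (ha.mul
    ((measurable_huber γ).comp_aemeasurable
      (Lp.aestronglyMeasurable v).aemeasurable).aestronglyMeasurable) ?_
  filter_upwards [hC] with x hx
  have h2 := huber_le_sq hγ (v x)
  have h3 := huber_nonneg hγ (v x)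
  have := (abs_nonneg _).trans hx
  rw [norm_mul, Real.norm_of_nonneg h3, mul_assoc]
  refine mul_le_mul hx (h2.trans (le_of_eq ?_)) h3 this
  rw [div_eq_inv_mul]

variable {E F : Type*} [MeasurableSpace E] {ν : Measure E} [NormedAddCommGroup F]
  [InnerProductSpace ℝ F] {a : E → ℝ} {C γ : ℝ}

theorem memLp_smul_huberGrad (ha : AEStronglyMeasurable a ν) (hC : ∀ᵐ x ∂ν, |a x| ≤ C)
    (hγ : 0 < γ) (v : Lp F 2 ν) : MemLp (fun x => a x • huberGrad γ (v x)) 2 ν := by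
  refine (Lp.memLp v).of_le_mul (c := C * γ⁻¹)
    (ha.smul ((continuous_huberGrad hγ).comp_aestronglyMeasurable (Lp.aestronglyMeasurable v))) ?_
  filter_upwards [hC] with x hx
  rw [norm_smul, mul_assoc]
  have := (abs_nonneg _).trans hx
  exact mul_le_mul hx (norm_huberGrad_le hγ _) (norm_nonneg _) this

variable [MeasurableSpace F] [BorelSpace F]

theorem hasQuadExpansion_integral_huber (ha : AEStronglyMeasurable a ν)
    (hC : ∀ᵐ x ∂ν, |a x| ≤ C) (ha0 : ∀ᵐ x ∂ν, 0 ≤ a x) (hγ : 0 < γ) (v : Lp F 2 ν) :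
    HasQuadExpansion (fun v : Lp F 2 ν => ∫ x, a x * huber γ (v x) ∂ν) v
      (innerSL ℝ ((memLp_smul_huberGrad ha hC hγ v).toLp _)) := by
  set g := (memLp_smul_huberGrad ha hC hγ v).toLp _
  have hg := (memLp_smul_huberGrad ha hC hγ v).coeFn_toLp
  have hint (v : Lp F 2 ν) := integrable_mul_huber ha hC hγ v
  constructor
  · intro h
    rw [innerSL_apply_apply, L2.inner_def, ← integral_add (hint v) (L2.integrable_inner g h)]
    refine integral_mono_ae ((hint v).add (L2.integrable_inner g h)) (hint _) ?_
    filter_upwards [hg, ha0, Lp.coeFn_add v h] with x h1 h2 h3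
    simp only [Pi.add_apply] at h3 ⊢
    rw [h1, h3, real_inner_smul_left, ← mul_add]
    exact mul_le_mul_of_nonneg_left (huber_lower hγ _ _) h2
  · intro h
    -- The pointwise remainder `‖t • h x‖ ^ 2 / (2 * γ)`, with the weight bounded by `C`, integrates
    -- to `t ^ 2` times this constant.
    refine ⟨C / (2 * γ) * ∫ x, ‖h x‖ ^ 2 ∂ν, fun t => ?_⟩
    have hsq : Integrable (fun x => ‖h x‖ ^ 2) ν :=
      (Lp.memLp h).integrable_norm_pow (by norm_num)
    have hi := (L2.integrable_inner (𝕜 := ℝ) g h).const_mul t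
    have hvi : Integrable (fun x => a x * huber γ (v x) + t * ⟪g x, h x⟫_ℝ) ν := (hint v).add hi
    have hs := (hsq.const_mul (C / (2 * γ))).const_mul (t ^ 2)
    rw [innerSL_apply_apply, L2.inner_def, ← integral_const_mul, ← integral_const_mul,
      ← integral_const_mul, ← integral_add (hint v) hi, ← integral_add hvi hs]
    refine integral_mono_ae (hint _) (hvi.add hs) ?_
    filter_upwards [hg, ha0, hC, Lp.coeFn_add v (t • h), Lp.coeFn_smul t h] with x h1 h2 h3 h4 h5
    simp only [Pi.add_apply, Pi.smul_apply] at h4 h5 ⊢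
    rw [h1, h4, h5, real_inner_smul_left]
    have h6 := mul_le_mul_of_nonneg_left (huber_upper hγ (v x) (t • h x)) h2
    rw [real_inner_smul_right, norm_smul, mul_pow, Real.norm_eq_abs, sq_abs] at h6
    have h7 : a x * (t ^ 2 * ‖h x‖ ^ 2 / (2 * γ)) ≤ C * (t ^ 2 * ‖h x‖ ^ 2 / (2 * γ)) := by
      have := (le_abs_self _).trans h3
      gcongr
    calc _ ≤ _ := h6
      _ ≤ a x * huber γ (v x) + a x * (t * ⟪huberGrad γ (v x), h x⟫_ℝ)
          + C * (t ^ 2 * ‖h x‖ ^ 2 / (2 * γ)) := by linarith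
      _ = _ := by ring

/-- The gradient of the Huber integral at `v`, and its pointwise characterization. -/
theorem exists_hasQuadExpansion_integral_huber (ha : AEStronglyMeasurable a ν)
    (hC : ∀ᵐ x ∂ν, |a x| ≤ C) (ha0 : ∀ᵐ x ∂ν, 0 ≤ a x) (hγ : 0 < γ) (v : Lp F 2 ν) :
    ∃ g : Lp F 2 ν,
      HasQuadExpansion (fun v : Lp F 2 ν => ∫ x, a x * huber γ (v x) ∂ν) v (innerSL ℝ g) ∧
      (∀ᵐ x ∂ν, g x = a x • huberGrad γ (v x)) ∧
      ∀ q : Lp F 2 ν, (∀ᵐ x ∂ν, max ‖v x‖ γ • q x - a x • v x = 0) ↔ q = g := by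
  have hg := (memLp_smul_huberGrad ha hC hγ v).coeFn_toLp
  refine ⟨_, hasQuadExpansion_integral_huber ha hC ha0 hγ v, hg, fun q => ?_⟩
  simp only [max_smul_sub_eq_zero_iff hγ]
  exact ⟨fun h => Lp.ext (EventuallyEq.trans h hg.symm), fun h => h ▸ hg⟩

end HuberIntegral

/-! ### The quadratic term Q₁ and the split of the stationarity equation. -/

theorem HasQuadExpansion.of_quadratic {X : Type*} [NormedAddCommGroup X] [NormedSpace ℝ X]
    {F N : X → ℝ} {x : X} {D : StrongDual ℝ X} (hF : ∀ h, F (x + h) = F x + D h + N h)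
    (hN : ∀ h, 0 ≤ N h) (hN2 : ∀ (t : ℝ) h, N (t • h) = t ^ 2 * N h) :
    HasQuadExpansion F x D where
  lower h := by linarith [hF h, hN h]
  upper h := ⟨N h, fun t => by rw [hF, hN2, map_smul, smul_eq_mul]⟩

theorem exists_abs_le_of_continuousOn_closure {X : Type*} [PseudoMetricSpace X] [ProperSpace X]
    {Ω : Set X} (hb : Bornology.IsBounded Ω) {a : X → ℝ}
    (ha : ContinuousOn a (closure Ω)) : ∃ C, ∀ x ∈ Ω, |a x| ≤ C := by
  obtain ⟨C, hC⟩ := hb.isCompact_closure.exists_bound_of_continuousOn ha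
  exact ⟨C, fun x hx => hC x (subset_closure hx)⟩

theorem eq_zero_iff_of_forall_apply_eq {X Y : Type*} [NormedAddCommGroup X] [NormedSpace ℝ X]
    [NormedAddCommGroup Y] [NormedSpace ℝ Y] {D : StrongDual ℝ (X × Y)} {A : StrongDual ℝ Y}
    {A' : StrongDual ℝ X} (e : ∀ h, D h = A' h.1 + A h.2) : D = 0 ↔ A = 0 ∧ A' = 0 := by
  constructor
  · rintro rfl
    exact ⟨ContinuousLinearMap.ext fun v => by simpa using (e (0, v)).symm,
      ContinuousLinearMap.ext fun v => by simpa using (e (v, 0)).symm⟩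
  · rintro ⟨rfl, rfl⟩
    exact ContinuousLinearMap.ext fun h => by simpa using e h

section Quadratic

variable {W U H L M : Type*} [NormedAddCommGroup W] [InnerProductSpace ℝ W]
  [NormedAddCommGroup U] [InnerProductSpace ℝ U] [NormedAddCommGroup H] [InnerProductSpace ℝ H]
  [NormedAddCommGroup L] [InnerProductSpace ℝ L] [NormedAddCommGroup M] [InnerProductSpace ℝ M]

/-- The derivative of `(w, u) ↦ ½‖K u - f‖² + (μ/2)‖G u‖² + (α/2)‖w‖²` at `z`. -/
noncomputable def quadDeriv (K : U →L[ℝ] H) (G : U →L[ℝ] L) (f : H) (μ α : ℝ) (z : W × U) :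
    StrongDual ℝ (W × U) :=
  (α • innerSL ℝ z.1).comp (ContinuousLinearMap.fst ℝ W U) +
    ((innerSL ℝ (K z.2 - f)).comp K + μ • (innerSL ℝ (G z.2)).comp G).comp
      (ContinuousLinearMap.snd ℝ W U)

theorem quadDeriv_apply (K : U →L[ℝ] H) (G : U →L[ℝ] L) (f : H) (μ α : ℝ) (z h : W × U) :
    quadDeriv K G f μ α z h = α * ⟪z.1, h.1⟫_ℝ +
      (⟪K z.2 - f, K h.2⟫_ℝ + μ * ⟪G z.2, G h.2⟫_ℝ) :=
  rfl

theorem hasQuadExpansion_quad (K : U →L[ℝ] H) (G : U →L[ℝ] L) (f : H) {μ α : ℝ} (hμ : 0 ≤ μ)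
    (hα : 0 ≤ α) (z : W × U) :
    HasQuadExpansion
      (fun z : W × U => 1 / 2 * ‖K z.2 - f‖ ^ 2 + μ / 2 * ‖G z.2‖ ^ 2 + α / 2 * ‖z.1‖ ^ 2) z
      (quadDeriv K G f μ α z) := by
  refine HasQuadExpansion.of_quadratic (N := fun h => 1 / 2 * ‖K h.2‖ ^ 2
    + μ / 2 * ‖G h.2‖ ^ 2 + α / 2 * ‖h.1‖ ^ 2) (fun h => ?_) (fun h => by positivity)
    (fun t h => ?_)
  · rw [quadDeriv_apply, Prod.snd_add, Prod.fst_add, map_add, map_add, add_sub_right_comm,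
      norm_add_sq_real, norm_add_sq_real, norm_add_sq_real]
    ring
  · simp only [Prod.smul_fst, Prod.smul_snd, map_smul, norm_smul, mul_pow, Real.norm_eq_abs,
      sq_abs]
    ring

/-- Varying `u` alone gives (Opt_1), varying `w` alone (Opt_2). By `hW` the gradient of the H¹ norm
yields both the `α w` and `-α Δw` terms; `-q` comes from the `-w` in `R`. -/
theorem quadDeriv_add_comp_eq_zero_iff {S : Submodule ℝ M} (K : U →L[ℝ] H) (G : U →L[ℝ] L)
    (ι : W →L[ℝ] L) (J : W →L[ℝ] M) (E : W →L[ℝ] S)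
    (hW : ∀ w v : W, ⟪w, v⟫_ℝ = ⟪ι w, ι v⟫_ℝ + ⟪J w, J v⟫_ℝ) (f : H) (μ α : ℝ) (w : W) (u : U)
    (p : S) (q : L) :
    quadDeriv K G f μ α (w, u) +
        ((innerSL ℝ p).comp (ContinuousLinearMap.fst ℝ S L) +
          (innerSL ℝ q).comp (ContinuousLinearMap.snd ℝ S L)).comp
        ((E.comp (ContinuousLinearMap.fst ℝ W U)).prod
          (G.comp (ContinuousLinearMap.snd ℝ W U) - ι.comp (ContinuousLinearMap.fst ℝ W U))) = 0 ↔
      (innerSL ℝ (K u)).comp K - μ • -((innerSL ℝ (G u)).comp G) + (innerSL ℝ q).comp G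
        - (innerSL ℝ f).comp K = 0 ∧
      α • (innerSL ℝ (ι w)).comp ι - α • -((innerSL ℝ (J w)).comp J) - (innerSL ℝ q).comp ι
        + (innerSL ℝ (p : M)).comp (S.subtypeL.comp E) = 0 := by
  refine eq_zero_iff_of_forall_apply_eq fun h => ?_
  simp only [quadDeriv_apply, add_apply, sub_apply, neg_apply, smul_apply, smul_eq_mul,
    ContinuousLinearMap.comp_apply, ContinuousLinearMap.prod_apply, ContinuousLinearMap.coe_fst',
    ContinuousLinearMap.coe_snd', innerSL_apply_apply, hW, inner_sub_left, inner_sub_right,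
    Submodule.subtypeL_apply, Submodule.coe_inner]
  ring

/-- The gradient of `Φ₀`, computed in all of `M`, already lies in `S`, so restriction to `S` needs
no projection. -/
theorem hasQuadExpansion_add_prod {S : Submodule ℝ M} {Φ₀ : M → ℝ} {Φ₁ : L → ℝ} {y g : S × L}
    (h₀ : HasQuadExpansion Φ₀ (y.1 : M) (innerSL ℝ (g.1 : M)))
    (h₁ : HasQuadExpansion Φ₁ y.2 (innerSL ℝ g.2)) :
    HasQuadExpansion (fun y : S × L => Φ₁ y.2 + Φ₀ (y.1 : M)) y
      ((innerSL ℝ g.1).comp (ContinuousLinearMap.fst ℝ S L) +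
        (innerSL ℝ g.2).comp (ContinuousLinearMap.snd ℝ S L)) where
  lower h := by
    have k₀ := h₀.lower h.1
    have k₁ := h₁.lower h.2
    simp only [innerSL_apply_apply, add_apply, ContinuousLinearMap.comp_apply,
      ContinuousLinearMap.coe_fst', ContinuousLinearMap.coe_snd', Submodule.coe_inner,
      Prod.fst_add, Prod.snd_add, Submodule.coe_add] at k₀ k₁ ⊢
    linarith
  upper h := by
    obtain ⟨c₀, k₀⟩ := h₀.upper h.1
    obtain ⟨c₁, k₁⟩ := h₁.upper h.2
    refine ⟨c₀ + c₁, fun t => ?_⟩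
    have k₀ := k₀ t
    have k₁ := k₁ t
    simp only [innerSL_apply_apply, add_apply, ContinuousLinearMap.comp_apply,
      ContinuousLinearMap.coe_fst', ContinuousLinearMap.coe_snd', Submodule.coe_inner,
      Prod.fst_add, Prod.snd_add, Submodule.coe_add, Prod.smul_fst, Prod.smul_snd,
      Submodule.coe_smul] at k₀ k₁ ⊢
    linarith

/-- Primal-dual optimality for `½‖K u - f‖² + (μ/2)‖G u‖² + (α/2)‖w‖² + Q (E w, G u - ι w)`. -/
theorem isMin_quad_add_and_isMin_dual_iff {S : Submodule ℝ M} (K : U →L[ℝ] H) (G : U →L[ℝ] L)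
    (ι : W →L[ℝ] L) (J : W →L[ℝ] M) (E : W →L[ℝ] S)
    (hW : ∀ w v : W, ⟪w, v⟫_ℝ = ⟪ι w, ι v⟫_ℝ + ⟪J w, J v⟫_ℝ) (f : H) {μ α : ℝ} (hμ : 0 ≤ μ)
    (hα : 0 ≤ α) (w : W) (u : U) (p : M) (q : L) {Q₀ : W × U → ℝ} {Q : S × L → ℝ}
    {R : W × U →L[ℝ] S × L} {P : S × L → StrongDual ℝ (S × L)}
    (hQ₀ : Q₀ = fun z : W × U =>
      1 / 2 * ‖K z.2 - f‖ ^ 2 + μ / 2 * ‖G z.2‖ ^ 2 + α / 2 * ‖z.1‖ ^ 2)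
    (hR : R = (E.comp (ContinuousLinearMap.fst ℝ W U)).prod
      (G.comp (ContinuousLinearMap.snd ℝ W U) - ι.comp (ContinuousLinearMap.fst ℝ W U)))
    (hP : P = fun y => (innerSL ℝ y.1).comp (ContinuousLinearMap.fst ℝ S L) +
      (innerSL ℝ y.2).comp (ContinuousLinearMap.snd ℝ S L))
    {Φ₀ : M → ℝ} {Φ₁ : L → ℝ} {c₀ c₁ : Prop}
    (h₀ : ∃ g ∈ S, HasQuadExpansion Φ₀ (E w : M) (innerSL ℝ g) ∧ (c₀ ↔ p = g))
    (h₁ : ∃ g, HasQuadExpansion Φ₁ (G u - ι w) (innerSL ℝ g) ∧ (c₁ ↔ q = g))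
    (hQ : Q = fun y => Φ₁ y.2 + Φ₀ (y.1 : M)) :
    ((∀ z, Q₀ (w, u) + Q (R (w, u)) ≤ Q₀ z + Q (R z)) ∧
      ∃ hp : p ∈ S, ∀ y : S × L,
        fenchelConj Q₀ (-((P (⟨p, hp⟩, q)).comp R)) + fenchelConj Q (P (⟨p, hp⟩, q)) ≤
          fenchelConj Q₀ (-((P y).comp R)) + fenchelConj Q (P y)) ↔
    ((innerSL ℝ (K u)).comp K - μ • -((innerSL ℝ (G u)).comp G) + (innerSL ℝ q).comp G
        - (innerSL ℝ f).comp K = 0 ∧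
      α • (innerSL ℝ (ι w)).comp ι - α • -((innerSL ℝ (J w)).comp J) - (innerSL ℝ q).comp ι
        + (innerSL ℝ p).comp (S.subtypeL.comp E) = 0 ∧ c₁ ∧ c₀) := by
  obtain ⟨g₀, hg₀, h₀, hc₀⟩ := h₀
  obtain ⟨g₁, h₁, hc₁⟩ := h₁
  rw [hc₀, hc₁]
  have hg : HasQuadExpansion Q (R (w, u)) (P (⟨g₀, hg₀⟩, g₁)) := by
    subst hR hP hQ
    exact hasQuadExpansion_add_prod (S := S) (y := (E w, G u - ι w)) (g := (⟨g₀, hg₀⟩, g₁)) h₀ h₁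
  have hq : HasQuadExpansion Q₀ (w, u) (quadDeriv K G f μ α (w, u)) :=
    hQ₀ ▸ hasQuadExpansion_quad K G f hμ hα (w, u)
  have key := fun p' : S => isMin_and_isMin_fenchelConj_iff (P := P) hq hg (p', q)
  have hD := fun p' : S => quadDeriv_add_comp_eq_zero_iff K G ι J E hW f μ α w u p' q
  -- The duality argument only identifies functionals; injectivity of the pairing recovers the
  -- functions `p` and `q`.
  have hinj : Function.Injective P := by
    intro y y' h
    subst hP
    refine Prod.ext (ext_inner_right ℝ fun v => ?_) (ext_inner_right ℝ fun v => ?_)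
    · simpa using congrArg (fun ξ => ξ (v, 0)) h
    · simpa using congrArg (fun ξ => ξ (0, v)) h
  constructor
  · rintro ⟨h1, hp, h2⟩
    obtain ⟨k, k'⟩ := (key ⟨p, hp⟩).1 ⟨h1, h2⟩
    obtain ⟨k1, k2⟩ := (hD ⟨p, hp⟩).1 (by rwa [hR, hP] at k)
    have k3 := hinj k'
    exact ⟨k1, k2, congrArg Prod.snd k3, congrArg (fun y => (y.1 : M)) k3⟩
  -- Symmetry of `p` is not assumed here: `c₀` forces `p = g₀`, and `g₀` lies in `S`.
  · rintro ⟨k1, k2, rfl, rfl⟩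
    obtain ⟨h1, h2⟩ := (key ⟨p, hg₀⟩).2 ⟨by rw [hR, hP]; exact (hD ⟨p, hg₀⟩).2 ⟨k1, k2⟩, rfl⟩
    exact ⟨h1, hg₀, h2⟩

end Quadratic

/-! ### Application to the Sobolev setting. -/

variable {d : ℕ} {Ω : Set (Vec d)}

/-- The Huber gradient at a symmetric matrix is a scalar multiple of that matrix. -/
theorem smul_huberGrad_mem_L2Sym {ψ g : L2 Ω (Mat d)} (hψ : ψ ∈ L2Sym Ω) {a : Vec d → ℝ} {γ : ℝ}
    (hg : ∀ᵐ x ∂(volume.restrict Ω), g x = a x • huberGrad γ (ψ x)) : g ∈ L2Sym Ω := by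
  change ∀ᵐ x ∂(volume.restrict Ω), ∀ i j, g x (i, j) = g x (j, i)
  have hψ' : ∀ᵐ x ∂(volume.restrict Ω), ∀ i j, ψ x (i, j) = ψ x (j, i) := hψ
  filter_upwards [hψ', hg] with x h1 h2 i j
  simp [h2, huberGrad, h1 i j]

variable {a : Vec d → ℝ} {c γ : ℝ}

theorem exists_hasQuadExpansion_setIntegral_huber {F : Type*} [NormedAddCommGroup F]
    [InnerProductSpace ℝ F] [MeasurableSpace F] [BorelSpace F] (hΩ : IsOpen Ω)
    (hb : Bornology.IsBounded Ω) (ha : ContinuousOn a (closure Ω)) (hc : 0 < c)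
    (hlow : ∀ x ∈ Ω, c < a x) (hγ : 0 < γ) (v : L2 Ω F) :
    ∃ g : L2 Ω F,
      HasQuadExpansion (fun v : L2 Ω F => ∫ x in Ω, a x * huber γ (v x)) v (innerSL ℝ g) ∧
      (∀ᵐ x ∂(volume.restrict Ω), g x = a x • huberGrad γ (v x)) ∧
      ∀ q : L2 Ω F,
        (∀ᵐ x ∂(volume.restrict Ω), max ‖v x‖ γ • q x - a x • v x = 0) ↔ q = g := by
  obtain ⟨C, hC⟩ := exists_abs_le_of_continuousOn_closure hb ha
  exact exists_hasQuadExpansion_integral_huber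
    ((ha.mono subset_closure).aestronglyMeasurable hΩ.measurableSet)
    ((ae_restrict_iff' hΩ.measurableSet).2 (Eventually.of_forall hC))
    ((ae_restrict_iff' hΩ.measurableSet).2
      (Eventually.of_forall fun x hx => (hc.trans (hlow x hx)).le)) hγ v

theorem exists_hasQuadExpansion_setIntegral_huber_vec (hΩ : IsOpen Ω)
    (hb : Bornology.IsBounded Ω) (ha : ContinuousOn a (closure Ω)) (hc : 0 < c)
    (hlow : ∀ x ∈ Ω, c < a x) (hγ : 0 < γ) (v q : L2 Ω (Vec d)) :
    ∃ g : L2 Ω (Vec d),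
      HasQuadExpansion (fun v : L2 Ω (Vec d) => ∫ x in Ω, a x * huber γ (v x)) v (innerSL ℝ g) ∧
      ((∀ᵐ x ∂(volume.restrict Ω), max ‖v x‖ γ • q x - a x • v x = 0) ↔ q = g) := by
  obtain ⟨g, h1, -, h2⟩ := exists_hasQuadExpansion_setIntegral_huber hΩ hb ha hc hlow hγ v
  exact ⟨g, h1, h2 q⟩

theorem exists_hasQuadExpansion_setIntegral_huber_sym (hΩ : IsOpen Ω)
    (hb : Bornology.IsBounded Ω) (ha : ContinuousOn a (closure Ω)) (hc : 0 < c)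
    (hlow : ∀ x ∈ Ω, c < a x) (hγ : 0 < γ) (v : L2Sym Ω) (p : L2 Ω (Mat d)) :
    ∃ g ∈ L2Sym Ω,
      HasQuadExpansion (fun v : L2 Ω (Mat d) => ∫ x in Ω, a x * huber γ (v x)) v (innerSL ℝ g) ∧
      ((∀ᵐ x ∂(volume.restrict Ω), max ‖(v : L2 Ω (Mat d)) x‖ γ • p x
        - a x • (v : L2 Ω (Mat d)) x = 0) ↔ p = g) := by
  obtain ⟨g, h1, h3, h2⟩ :=
    exists_hasQuadExpansion_setIntegral_huber hΩ hb ha hc hlow hγ (v : L2 Ω (Mat d))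
  exact ⟨g, smul_huberGrad_mem_L2Sym v.2 h3, h1, h2 p⟩

end TGV

theorem proposition4p3 {d : ℕ} {Ω : Set (TGV.Vec d)} (hΩ : IsOpen Ω)
    (hb : Bornology.IsBounded Ω) {s : ℝ≥0∞} [Fact (1 ≤ s)] (hs : s ≤ 2)
    (T : Lp ℝ s (volume.restrict Ω) →L[ℝ] TGV.L2 Ω ℝ) (f : TGV.L2 Ω ℝ)
    (α₀ α₁ : TGV.Vec d → ℝ) (hα₀ : ContinuousOn α₀ (closure Ω)) (hα₁ : ContinuousOn α₁ (closure Ω))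
    (αlow : ℝ) (hαlow : 0 < αlow) (hlow : ∀ x ∈ Ω, αlow < α₀ x ∧ αlow < α₁ x)
    (μ α γ₀ γ₁ : ℝ) (hμ : 0 < μ) (hα : 0 < α) (hγ₀ : 0 < γ₀) (hγ₁ : 0 < γ₁)
    (w : TGV.H1Vec Ω) (u : TGV.H1 Ω) (p : TGV.L2 Ω (TGV.Mat d)) (q : TGV.L2 Ω (TGV.Vec d)) :
    (TGV.IsPrimalSolution hb hs T f α₀ α₁ μ α γ₀ γ₁ w u ∧
      TGV.IsPredualSolution hb hs T f α₀ α₁ μ α γ₀ γ₁ p q) ↔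
    ((TGV.opB T (TGV.H1toLs hb hs u)).comp (TGV.H1toLs hb hs) - μ • TGV.lap u + TGV.gradAdj q
        - (TGV.adjT T f).comp (TGV.H1toLs hb hs) = 0 ∧
      α • TGV.l2Dual (TGV.toL2Vec Ω w) - α • TGV.lapVec w - TGV.l2Dual q + TGV.symGradAdj p = 0 ∧
      (∀ᵐ x ∂(volume.restrict Ω),
        max ‖(TGV.grad Ω u - TGV.toL2Vec Ω w) x‖ γ₁ • q x
          - α₁ x • (TGV.grad Ω u - TGV.toL2Vec Ω w) x = 0) ∧
      (∀ᵐ x ∂(volume.restrict Ω),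
        max ‖(TGV.symGrad Ω w : TGV.L2 Ω (TGV.Mat d)) x‖ γ₀ • p x
          - α₀ x • (TGV.symGrad Ω w : TGV.L2 Ω (TGV.Mat d)) x = 0)) := by
  -- The first `rfl` is the H¹ inner product, which on the graph of the weak Jacobian is the sum of
  -- the two L² inner products by construction.
  exact TGV.isMin_quad_add_and_isMin_dual_iff (T.comp (TGV.H1toLs hb hs)) (TGV.grad Ω)
    (TGV.toL2Vec Ω) (TGV.jac Ω) (TGV.symGrad Ω) (fun _ _ => rfl) f hμ.le hα.le w u p q rfl rfl rfl
    (TGV.exists_hasQuadExpansion_setIntegral_huber_sym hΩ hb hα₀ hαlow (fun x hx => (hlow x hx).1)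
      hγ₀ (TGV.symGrad Ω w) p)
    (TGV.exists_hasQuadExpansion_setIntegral_huber_vec hΩ hb hα₁ hαlow (fun x hx => (hlow x hx).2)
      hγ₁ (TGV.grad Ω u - TGV.toL2Vec Ω w) q)
    rfl
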